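/- Let $d\in\mathbb N$ be any dimension, and let $\mu$ be a finite positive Borel measure on $\mathbb{R}^d$ with compact support and $\mu(\mathbb{R}^d)>0$. Let $p\ge 1$ and $\lambda>0$. Let $\mathcal C$ be the class of all curves $\gamma:[0,a]\to\mathbb{R}^d$, with $a\ge 0$ arbitrary, that are Lipschitz with $|\gamma'|\le 1$ a.e. For $\gamma\in\mathcal C$ put $\Gamma_\gamma=\gamma([0,a])$, let $\mathrm{Length}(\gamma)$ be the total variation of $\gamma$ on $[0,a]$, and let $$E_\mu^{\lambda,p}(\gamma)=\int_{\mathbb{R}^d} d(x,\Gamma_\gamma)^p\,d\mu(x)+\lambda\,\mathrm{Length}(\gamma).$$ For an integrable $u:(a,b)\to\mathbb{R}^d$ let $$\|u\|_{TV((a,b))}=\sup\Big\{\int_a^b u\cdot\varphi'\,dt:\ \varphi\in C^1_c((a,b);\mathbb{R}^d),\ |\varphi|\le 1\Big\}$$ be the total variation of its distributional derivative; $u$ is of bounded variation if this is finite. Let $\gamma:[0,L]\to\mathbb{R}^d$ be an arc-length-parameterized minimizer of $E_\mu^{\lambda,p}$ over $\mathcal C$. Then $\gamma'$ is of bounded variation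 on $[0,L]$ and $$\|\gamma'\|_{TV((0,L))}\le \frac p\lambda\,\operatorname{diam}(\operatorname{supp}\mu)^{p-1}\,\mu(\mathbb{R}^d),$$ where $0^0=1$. Moreover, let $\pi$ be any measure on $\mathbb{R}^d\times\mathbb{R}^d$ concentrated on $\mathbb{R}^d\times\Gamma_\gamma$, with first marginal $\mu$, such that $|x-y|=\min_{z\in\Gamma_\gamma}|x-z|$ for $\pi$-a.e. $(x,y)$, and let $\sigma$ be its second marginal (a projection of $\mu$ onto the curve). Then for every interval $I=(t,t+\delta)\subset[0,L]$ with $\delta>0$, $$\|\gamma'\|_{TV(I)}\le \frac p\lambda\,\operatorname{diam}(\operatorname{supp}\mu)^{p-1}\,\sigma(\gamma(I)).$$ -/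

import Mathlib

open MeasureTheory Set
open scoped ENNReal RealInnerProductSpace

namespace AvgDist

/-- `ℝ^d` with its Euclidean norm. -/
abbrev Space (d : ℕ) : Type := EuclideanSpace ℝ (Fin d)

/-- The class `𝓜`: nonzero finite positive Borel measures on `ℝ^d` with compact support. -/
structure IsData {d : ℕ} (μ : Measure (Space d)) : Prop where
  finite : IsFiniteMeasure μ
  compact_support : IsCompact μ.support
  pos : 0 < μ univ

/-- The class `𝓒`: curves `γ : [0,a] → ℝ^d`, `a ≥ 0`, that are Lipschitz with `|γ'| ≤ 1` a.e.
A curve is given by a map on `ℝ` of which only the restriction to `[0,a]` matters. -/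
structure IsCurve {d : ℕ} (a : ℝ) (γ : ℝ → Space d) : Prop where
  nonneg : 0 ≤ a
  lipschitz : ∃ K, LipschitzOnWith K γ (Icc 0 a)
  norm_deriv_le : ∀ᵐ t ∂(volume.restrict (Ioo 0 a)), ‖deriv γ t‖ ≤ 1

/-- The image `Γ_γ = γ([0,a])`. -/
def image {d : ℕ} (a : ℝ) (γ : ℝ → Space d) : Set (Space d) := γ '' Icc 0 a

/-- The energy `∫ d(x, Γ_γ)^p dμ(x) + lam * Length(γ)`, as an extended nonnegative number; the
length is the total variation of `γ` on `[0,a]`. -/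
noncomputable def energy {d : ℕ} (μ : Measure (Space d)) (lam p : ℝ)
    (a : ℝ) (γ : ℝ → Space d) : ℝ≥0∞ :=
  (∫⁻ x, (Metric.infEDist x (image a γ)) ^ p ∂μ) + ENNReal.ofReal lam * eVariationOn γ (Icc 0 a)

/-- `γ : [0,a] → ℝ^d` minimizes the energy over the class `𝓒` (in which the length `b` of the
parameter interval is free). -/
structure IsMinimizer {d : ℕ} (μ : Measure (Space d)) (lam p : ℝ)
    (a : ℝ) (γ : ℝ → Space d) : Prop where
  isCurve : IsCurve a γ
  le : ∀ (b : ℝ) (η : ℝ → Space d), IsCurve b η → energy μ lam p a γ ≤ energy μ lam p b η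

/-- The total variation `|Du|((a,b))` of the distributional derivative of a (vector-valued)
function `u` on the open interval `(a,b)`: the supremum of `∫ ⟪u, φ'⟫` over all
`φ ∈ C¹_c((a,b); ℝ^d)` with `|φ| ≤ 1`. It depends only on the a.e. class of `u`. -/
noncomputable def totalVariation {d : ℕ} (u : ℝ → Space d) (a b : ℝ) : ℝ≥0∞ :=
  ⨆ φ ∈ {φ : ℝ → Space d | ContDiff ℝ 1 φ ∧ HasCompactSupport φ ∧ tsupport φ ⊆ Ioo a b ∧
      ∀ t, ‖φ t‖ ≤ 1},
    ENNReal.ofReal (∫ t in Ioo a b, ⟪u t, deriv φ t⟫)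

/-- `u ∈ BV`: `u` is integrable on `(a,b)` and its distributional derivative has finite total
variation there. -/
def IsBV {d : ℕ} (u : ℝ → Space d) (a b : ℝ) : Prop :=
  IntegrableOn u (Ioo a b) ∧ totalVariation u a b < ∞

/-- `π` transports `μ` to closest points of `Γ`: it is a measure on `ℝ^d × ℝ^d` concentrated on
`ℝ^d × Γ` with first marginal `μ` such that `|x - y| = min_{z ∈ Γ} |x - z|` for `π`-a.e.
`(x, y)`. -/
structure IsProjectionPlan {d : ℕ} (μ : Measure (Space d)) (Γ : Set (Space d))
    (π : Measure (Space d × Space d)) : Prop where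
  fst_eq : π.map Prod.fst = μ
  mem : ∀ᵐ z ∂π, z.2 ∈ Γ
  closest : ∀ᵐ z ∂π, dist z.1 z.2 = Metric.infDist z.1 Γ

end AvgDist

open AvgDist

namespace AvgDist

open Filter Topology
open scoped NNReal

/-! ### Length of a Lipschitz curve from a bound on its speed -/

section Length

variable {E : Type*} [NormedAddCommGroup E] [InnerProductSpace ℝ E] [FiniteDimensional ℝ E]

/-! Compare `γ` with `γ - ε • φ` for a test field `φ`, `|φ| ≤ 1`. Since `|γ'| ≤ 1`, the length drops
by at least `ε ∫ ⟪γ', φ'⟫`, up to `O(ε²)`. A point whose nearest point on the curve is `γ s` sees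
its distance grow by at most `ε`, and not at all if `φ s = 0`. With `D` the diameter of the support,
the distance term thus grows by at most `p ε (D + ε)^(p-1)` times the mass projected to `γ (tsupport
φ)`. Minimality, division by `ε` and `ε → 0` give both bounds
(`IsMinimizer.integral_inner_deriv_le`).

This uses that points of the support lie within `D` of the curve (`IsMinimizer.infDist_le_diam`): a
minimizer missing a closed convex set that carries `μ` would be improved by projecting it onto that
set. -/

theorem ae_differentiableAt_Ioo {f : ℝ → E} {K : ℝ≥0} {a b : ℝ}
    (hf : LipschitzOnWith K f (Icc a b)) :
    ∀ᵐ t ∂(volume.restrict (Ioo a b)), DifferentiableAt ℝ f t := by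
  rw [ae_restrict_iff' measurableSet_Ioo]
  filter_upwards [hf.ae_differentiableWithinAt_of_mem_real] with t ht hts
  exact (ht (Ioo_subset_Icc_self hts)).differentiableAt (Icc_mem_nhds hts.1 hts.2)

/-- Pairing `f` with the fixed vector `v = f b - f a` reduces to the scalar fundamental theorem of
calculus, giving `‖v‖² ≤ ‖v‖ ∫ g`. -/
theorem norm_sub_le_integral_of_lipschitzOnWith {f : ℝ → E} {K : ℝ≥0} {a b : ℝ} (hab : a ≤ b)
    (hf : LipschitzOnWith K f (Icc a b)) {g : ℝ → ℝ} (hg : IntegrableOn g (Ioo a b))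
    (hfg : ∀ᵐ t ∂(volume.restrict (Ioo a b)), ‖deriv f t‖ ≤ g t) :
    ‖f b - f a‖ ≤ ∫ t in Ioo a b, g t := by
  set v := f b - f a with hv
  have hlip : LipschitzOnWith (‖v‖₊ * K) (fun r => ⟪v, f r⟫) (uIcc a b) := by
    rw [uIcc_of_le hab]
    refine LipschitzOnWith.of_dist_le_mul fun x hx y hy => ?_
    rw [Real.dist_eq, ← inner_sub_right]
    have h1 := abs_real_inner_le_norm v (f x - f y)
    have h2 := hf.dist_le_mul x hx y hy
    rw [dist_eq_norm] at h2
    push_cast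
    calc _ ≤ ‖v‖ * ‖f x - f y‖ := h1
      _ ≤ ‖v‖ * (K * dist x y) := by gcongr
      _ = _ := by ring
  have hac := hlip.absolutelyContinuousOnInterval
  have hftc := hac.integral_deriv_eq_sub
  have hint := hac.intervalIntegrable_deriv
  rw [intervalIntegrable_iff_integrableOn_Ioo_of_le hab] at hint
  rw [intervalIntegral.integral_of_le hab, integral_Ioc_eq_integral_Ioo, ← inner_sub_right, ← hv,
    real_inner_self_eq_norm_sq] at hftc
  have hle : ‖v‖ ^ 2 ≤ ‖v‖ * ∫ t in Ioo a b, g t := by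
    rw [← hftc, ← integral_const_mul]
    refine integral_mono_ae hint (hg.const_mul _) ?_
    filter_upwards [hfg, ae_differentiableAt_Ioo hf] with t h1 h2
    have : deriv (fun r => ⟪v, f r⟫) t = ⟪v, deriv f t⟫ := by
      have := (hasDerivAt_const t v).inner ℝ h2.hasDerivAt
      simpa using this.deriv
    rw [this]
    exact (real_inner_le_norm _ _).trans (by gcongr)
  rcases (norm_nonneg v).eq_or_lt with h0 | h0
  · rw [← h0]
    refine integral_nonneg_of_ae ?_
    filter_upwards [hfg] with t ht using (norm_nonneg _).trans ht
  · nlinarith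

/-- Increments of `f` are dominated by those of the primitive `G` of `g`, which is monotone, so its
variation is `G b - G a`. -/
theorem eVariationOn_le_integral_of_lipschitzOnWith {f : ℝ → E} {K : ℝ≥0} {a b : ℝ} (hab : a ≤ b)
    (hf : LipschitzOnWith K f (Icc a b)) {g : ℝ → ℝ} (hg : IntegrableOn g (Ioo a b))
    (hfg : ∀ᵐ t ∂(volume.restrict (Ioo a b)), ‖deriv f t‖ ≤ g t) :
    eVariationOn f (Icc a b) ≤ ENNReal.ofReal (∫ t in Ioo a b, g t) := by
  set G : ℝ → ℝ := fun x => ∫ t in a..x, g t with hG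
  have hgi : ∀ x ∈ Icc a b, ∀ y ∈ Icc a b, IntervalIntegrable g volume x y := by
    have : IntervalIntegrable g volume a b :=
      (intervalIntegrable_iff_integrableOn_Ioo_of_le hab).2 hg
    intro x hx y hy
    exact this.mono_set (by rw [uIcc_of_le hab]; exact uIcc_subset_Icc hx hy)
  have hdiff : ∀ x ∈ Icc a b, ∀ y ∈ Icc a b, x ≤ y → ‖f y - f x‖ ≤ G y - G x := by
    intro x hx y hy hxy
    have ha : a ∈ Icc a b := left_mem_Icc.2 hab
    rw [hG]
    simp only
    rw [intervalIntegral.integral_interval_sub_left (hgi a ha y hy) (hgi a ha x hx),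
      intervalIntegral.integral_of_le hxy, integral_Ioc_eq_integral_Ioo]
    have hsub : Ioo x y ⊆ Ioo a b := Ioo_subset_Ioo hx.1 hy.2
    exact norm_sub_le_integral_of_lipschitzOnWith hxy (hf.mono (Icc_subset_Icc hx.1 hy.2))
      (hg.mono_set hsub) (ae_restrict_of_ae_restrict_of_subset hsub hfg)
  have hmono : MonotoneOn G (Icc a b) := fun x hx y hy hxy =>
    sub_nonneg.1 ((norm_nonneg _).trans (hdiff x hx y hy hxy))
  have hle : eVariationOn f (Icc a b) ≤ eVariationOn G (Icc a b) := by
    refine iSup_mono fun q => Finset.sum_le_sum fun i _ => ?_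
    obtain ⟨n, u, hu, us⟩ := q
    rw [edist_dist, edist_dist]
    refine ENNReal.ofReal_le_ofReal ?_
    rw [dist_eq_norm, Real.dist_eq]
    exact (hdiff _ (us i) _ (us (i + 1)) (hu (Nat.le_succ i))).trans (le_abs_self _)
  have hvar := hmono.eVariationOn_eq (left_mem_Icc.2 hab) (right_mem_Icc.2 hab)
  rw [inter_self] at hvar
  refine hle.trans_eq (hvar.trans ?_)
  congr 1
  simp only [hG, intervalIntegral.integral_same, sub_zero]
  rw [intervalIntegral.integral_of_le hab, integral_Ioc_eq_integral_Ioo]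

end Length

/-! ### Two convexity tools -/

/-- Bernoulli's inequality for the ratio `x / (x + ε)`: the graph of `r ↦ r ^ p` lies above its
tangent at `x + ε`. -/
theorem add_rpow_le_rpow_add_mul {p x ε D : ℝ} (hp : 1 ≤ p) (hx : 0 ≤ x) (hε : 0 < ε)
    (hxD : x ≤ D) : (x + ε) ^ p ≤ x ^ p + p * ε * (D + ε) ^ (p - 1) := by
  have hy : 0 < x + ε := by positivity
  have hb : 1 + p * (-ε / (x + ε)) ≤ (1 + -ε / (x + ε)) ^ p :=
    one_add_mul_self_le_rpow_one_add (by rw [le_div_iff₀ hy]; linarith) hp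
  have hfrac : 1 + -ε / (x + ε) = x / (x + ε) := by field_simp; ring
  rw [hfrac, Real.div_rpow hx hy.le, le_div_iff₀ (by positivity)] at hb
  have hsplit : (x + ε) ^ p = (x + ε) ^ (p - 1) * (x + ε) := by
    rw [← Real.rpow_add_one hy.ne', sub_add_cancel]
  have hexp : (1 + p * (-ε / (x + ε))) * (x + ε) ^ p
      = (x + ε) ^ p - p * ε * (x + ε) ^ (p - 1) := by
    rw [hsplit]; field_simp; ring
  have hmono : (x + ε) ^ (p - 1) ≤ (D + ε) ^ (p - 1) :=
    Real.rpow_le_rpow hy.le (by linarith) (by linarith)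
  have : p * ε * (x + ε) ^ (p - 1) ≤ p * ε * (D + ε) ^ (p - 1) := by gcongr
  linarith

/-- The nearest-point projection onto a closed convex set. -/
theorem exists_convex_projection {F : Type*} [NormedAddCommGroup F] [InnerProductSpace ℝ F]
    [CompleteSpace F] {K : Set F} (hne : K.Nonempty) (hK : IsClosed K) (hc : Convex ℝ K) :
    ∃ P : F → F, LipschitzWith 1 P ∧ ∀ y ∉ K, ∀ x ∈ K, dist x (P y) < dist x y := by
  choose P hPK hP using exists_norm_eq_iInf_of_complete_convex hne hK.isComplete hc
  have hin : ∀ u, ∀ w ∈ K, ⟪u - P u, w - P u⟫ ≤ 0 := fun u =>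
    (norm_eq_iInf_iff_real_inner_le_zero hc (hPK u)).1 (hP u)
  refine ⟨P, LipschitzWith.of_dist_le_mul fun u v => ?_, fun y hy x hx => ?_⟩
  · have h1 := hin u (P v) (hPK v)
    have h2 := hin v (P u) (hPK u)
    -- Sum of the two variational inequalities.
    have h3 : ‖P u - P v‖ ^ 2 ≤ ⟪u - v, P u - P v⟫ := by
      rw [← real_inner_self_eq_norm_sq]
      simp only [inner_sub_left, inner_sub_right] at h1 h2 ⊢
      linarith
    have h4 := real_inner_le_norm (u - v) (P u - P v)
    simp only [NNReal.coe_one, one_mul, dist_eq_norm]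
    nlinarith [norm_nonneg (P u - P v), norm_nonneg (u - v)]
  · have h1 := hin y x hx
    have hpos : 0 < ‖y - P y‖ := by
      rw [norm_pos_iff, sub_ne_zero]
      rintro h
      exact hy (h ▸ hPK y)
    have h2 : ‖x - y‖ ^ 2 = ‖x - P y‖ ^ 2 - 2 * ⟪y - P y, x - P y⟫ + ‖y - P y‖ ^ 2 := by
      rw [show x - y = (x - P y) - (y - P y) by abel, norm_sub_sq_real, real_inner_comm]
    simp only [dist_eq_norm]
    refine lt_of_pow_lt_pow_left₀ 2 (norm_nonneg _) ?_
    have : 0 < ‖y - P y‖ ^ 2 := by positivity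
    linarith

/-! ### Competitors, and the distance from the support to a minimizer -/

variable {d : ℕ} {μ : Measure (Space d)} {lam p L : ℝ} {γ : ℝ → Space d}

theorem image_nonempty (hL : 0 ≤ L) (γ : ℝ → Space d) : (image L γ).Nonempty :=
  (nonempty_Icc.2 hL).image γ

theorem isCompact_image {K : ℝ≥0} (hγ : LipschitzOnWith K γ (Icc 0 L)) :
    IsCompact (image L γ) :=
  isCompact_Icc.image_of_continuousOn hγ.continuousOn

/-- A Lipschitz curve, run slowly enough, belongs to the class of admissible curves. -/
theorem IsMinimizer.le_of_lipschitzOnWith (hmin : IsMinimizer μ lam p L γ) {b : ℝ} (hb : 0 ≤ b)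
    {η : ℝ → Space d} {K : ℝ≥0} (hη : LipschitzOnWith K η (Icc 0 b)) :
    energy μ lam p L γ ≤ energy μ lam p b η := by
  -- Slowing down by `K + 1` rather than `K` also covers `K = 0`; image and variation do not change.
  have hK : (0 : ℝ) < K + 1 := by positivity
  set ψ : ℝ → ℝ := fun s => s / (K + 1) with hψ
  have himg : ψ '' Icc 0 ((K + 1) * b) = Icc 0 b := by
    ext t
    constructor
    · rintro ⟨s, hs, rfl⟩
      exact ⟨div_nonneg hs.1 hK.le, (div_le_iff₀ hK).2 (by linarith [hs.2])⟩
    · intro ht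
      refine ⟨(K + 1) * t, ⟨mul_nonneg hK.le ht.1, by gcongr; exact ht.2⟩, ?_⟩
      simp only [hψ]
      field_simp
  have hmaps : MapsTo ψ (Icc 0 ((K + 1) * b)) (Icc 0 b) := by
    rw [← himg]; exact mapsTo_image _ _
  have hlip : LipschitzOnWith 1 (η ∘ ψ) (Icc 0 ((K + 1) * b)) := by
    refine LipschitzOnWith.of_dist_le_mul fun x hx y hy => ?_
    have h := hη.dist_le_mul _ (hmaps hx) _ (hmaps hy)
    refine h.trans ?_
    simp only [hψ, Real.dist_eq, ← sub_div, abs_div, abs_of_pos hK, NNReal.coe_one, one_mul]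
    rw [mul_div_assoc', div_le_iff₀ hK]
    nlinarith [abs_nonneg (x - y)]
  have hcurve : IsCurve ((K + 1) * b) (η ∘ ψ) := by
    refine ⟨by positivity, ⟨1, hlip⟩, ?_⟩
    refine (ae_restrict_iff' measurableSet_Ioo).2 (Eventually.of_forall fun t ht => ?_)
    simpa using norm_deriv_le_of_lipschitzOn (Icc_mem_nhds ht.1 ht.2) hlip
  have hle := hmin.le _ _ hcurve
  have hmonoψ : MonotoneOn ψ (Icc 0 ((K + 1) * b)) := fun x _ y _ hxy => by
    simp only [hψ]; gcongr
  rwa [energy, energy, image, image, image_comp, himg, eVariationOn.comp_eq_of_monotoneOn _ _ hmonoψ,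
    himg] at hle

/-- The competitor is the one-point curve at the origin. -/
theorem IsData.energy_ne_top (hμ : IsData μ) (hp : 1 ≤ p) (hmin : IsMinimizer μ lam p L γ) :
    energy μ lam p L γ ≠ ∞ := by
  have := hμ.finite
  have hconst : LipschitzOnWith 0 (fun _ : ℝ => (0 : Space d)) (Icc 0 0) :=
    (LipschitzWith.const _).lipschitzOnWith
  have hle := hmin.le_of_lipschitzOnWith le_rfl hconst
  refine ne_top_of_le_ne_top ?_ hle
  obtain ⟨R, hR⟩ := hμ.compact_support.isBounded.subset_closedBall (0 : Space d)
  have hvar : eVariationOn (fun _ : ℝ => (0 : Space d)) (Icc 0 0) = 0 :=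
    eVariationOn.subsingleton _ (by simp)
  rw [energy, hvar, mul_zero, add_zero]
  have hint : (∫⁻ x, Metric.infEDist x (image 0 fun _ => (0 : Space d)) ^ p ∂μ)
      ≤ ∫⁻ _, ENNReal.ofReal R ^ p ∂μ := by
    refine lintegral_mono_ae ?_
    filter_upwards [Measure.support_mem_ae (μ := μ)] with x hx
    have hmem : (0 : Space d) ∈ image 0 fun _ : ℝ => (0 : Space d) := ⟨0, by simp, rfl⟩
    refine ENNReal.rpow_le_rpow ((Metric.infEDist_le_edist_of_mem hmem).trans ?_) (by linarith)
    rw [edist_dist]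
    exact ENNReal.ofReal_le_ofReal (hR hx)
  refine ne_top_of_le_ne_top ?_ hint
  rw [lintegral_const]
  exact ENNReal.mul_ne_top (ENNReal.rpow_ne_top_of_nonneg (by linarith) ENNReal.ofReal_ne_top)
    (measure_ne_top _ _)

/-- A minimizer meets every closed convex set that carries the measure. -/
theorem IsMinimizer.inter_nonempty (hμ : IsData μ) (hp : 1 ≤ p)
    (hmin : IsMinimizer μ lam p L γ) {C : Set (Space d)} (hC : IsClosed C) (hconv : Convex ℝ C)
    (hsupp : μ.support ⊆ C) : (image L γ ∩ C).Nonempty := by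
  have := hμ.finite
  have hμ0 : μ ≠ 0 := fun h => by simpa [h] using hμ.pos
  by_contra hempty
  rw [not_nonempty_iff_eq_empty] at hempty
  obtain ⟨P, hPlip, hP⟩ := exists_convex_projection
    ((Measure.nonempty_support hμ0).mono hsupp) hC hconv
  obtain ⟨K, hK⟩ := hmin.isCurve.lipschitz
  -- `P ∘ γ` is no longer than `γ` and, as `γ` misses `C`, strictly closer to every point of the
  -- support.
  have hcomp : LipschitzOnWith (1 * K) (P ∘ γ) (Icc 0 L) := hPlip.comp_lipschitzOnWith hK
  have hle := hmin.le_of_lipschitzOnWith hmin.isCurve.nonneg hcomp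
  have hvar : eVariationOn (P ∘ γ) (Icc 0 L) ≤ eVariationOn γ (Icc 0 L) := by
    simpa using (hPlip.lipschitzOnWith (s := univ)).comp_eVariationOn_le (mapsTo_univ γ (Icc 0 L))
  have hfin := hμ.energy_ne_top hp hmin
  have hp0 : 0 < p := by linarith
  have hlt : ∀ᵐ x ∂μ, Metric.infEDist x (image L (P ∘ γ)) ^ p < Metric.infEDist x (image L γ) ^ p := by
    filter_upwards [Measure.support_mem_ae (μ := μ)] with x hx
    refine ENNReal.rpow_lt_rpow ?_ hp0
    obtain ⟨y, hy, hxy⟩ := (isCompact_image hK).exists_infEDist_eq_edist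
      (image_nonempty hmin.isCurve.nonneg γ) x
    have hyC : y ∉ C := fun h => (hempty ▸ (⟨hy, h⟩ : y ∈ image L γ ∩ C) : y ∈ (∅ : Set (Space d)))
    have hPy : P y ∈ image L (P ∘ γ) := by
      obtain ⟨t, ht, rfl⟩ := hy
      exact ⟨t, ht, rfl⟩
    rw [hxy]
    refine (Metric.infEDist_le_edist_of_mem hPy).trans_lt ?_
    rw [edist_dist, edist_dist]
    exact (ENNReal.ofReal_lt_ofReal_iff_of_nonneg dist_nonneg).2 (hP y hyC x (hsupp hx))
  have hfin1 : (∫⁻ x, Metric.infEDist x (image L γ) ^ p ∂μ) ≠ ∞ :=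
    ne_top_of_le_ne_top hfin le_self_add
  have hfin2 : ENNReal.ofReal lam * eVariationOn γ (Icc 0 L) ≠ ∞ :=
    ne_top_of_le_ne_top hfin le_add_self
  have hfin3 : (∫⁻ x, Metric.infEDist x (image L (P ∘ γ)) ^ p ∂μ) ≠ ∞ :=
    ne_top_of_le_ne_top hfin1 (lintegral_mono_ae (hlt.mono fun _ h => h.le))
  have hstrict := lintegral_strict_mono hμ0
    (Metric.continuous_infEDist.measurable.pow_const p).aemeasurable hfin3 hlt
  refine absurd hle (not_le.2 ?_)
  exact ENNReal.add_lt_add_of_lt_of_le (ne_top_of_le_ne_top hfin2 (by gcongr)) hstrict (by gcongr)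

theorem IsMinimizer.infDist_le_diam (hμ : IsData μ) (hp : 1 ≤ p)
    (hmin : IsMinimizer μ lam p L γ) {x : Space d} (hx : x ∈ μ.support) :
    Metric.infDist x (image L γ) ≤ Metric.diam μ.support := by
  obtain ⟨y, hy, hyx⟩ := hmin.inter_nonempty hμ hp (Metric.isClosed_closedBall (x := x))
    (convex_closedBall x (Metric.diam μ.support)) fun z hz =>
      Metric.dist_le_diam_of_mem hμ.compact_support.isBounded hz hx
  exact (Metric.infDist_le_dist_of_mem hy).trans (by rw [dist_comm]; exact hyx)

theorem infEDist_eq_ofReal {X : Type*} [PseudoMetricSpace X] {s : Set X} (hs : s.Nonempty)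
    (x : X) : Metric.infEDist x s = ENNReal.ofReal (Metric.infDist x s) :=
  (ENNReal.ofReal_toReal (Metric.infEDist_ne_top hs)).symm

/-! ### First variation -/

theorem exists_eVariationOn_sub_smul_le (hγ : IsCurve L γ) {φ : ℝ → Space d}
    (hφ : ContDiff ℝ 1 φ) (hφc : HasCompactSupport φ) :
    ∃ C : ℝ, ∀ ε : ℝ, 0 < ε →
      (∃ K, LipschitzOnWith K (γ - ε • φ) (Icc 0 L)) ∧
      0 ≤ L - ε * (∫ t in Ioo 0 L, ⟪deriv γ t, deriv φ t⟫) + C * ε ^ 2 ∧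
      eVariationOn (γ - ε • φ) (Icc 0 L) ≤
        ENNReal.ofReal (L - ε * (∫ t in Ioo 0 L, ⟪deriv γ t, deriv φ t⟫) + C * ε ^ 2) := by
  obtain ⟨K, hK⟩ := hγ.lipschitz
  obtain ⟨K', hK'⟩ := hφ.lipschitzWith_of_hasCompactSupport hφc (by norm_num)
  have hφd : ∀ t, ‖deriv φ t‖ ≤ K' := fun t => norm_deriv_le_of_lipschitz hK'
  have hint : IntegrableOn (fun t => ⟪deriv γ t, deriv φ t⟫) (Ioo 0 L) := by
    refine Integrable.of_bound (C := K') ?_ ?_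
    · exact ((stronglyMeasurable_deriv γ).inner (stronglyMeasurable_deriv φ)).aestronglyMeasurable
    · filter_upwards [hγ.norm_deriv_le] with t ht
      refine (norm_inner_le_norm _ _).trans ?_
      nlinarith [hφd t, norm_nonneg (deriv φ t), norm_nonneg (deriv γ t)]
  refine ⟨K' ^ 2 / 2 * L, fun ε hε => ?_⟩
  have hlip : LipschitzOnWith (K + ‖ε‖₊ * K') (γ - ε • φ) (Icc 0 L) := by
    refine hK.sub (LipschitzWith.lipschitzOnWith ?_)
    exact (lipschitzWith_smul ε).comp hK'
  -- From `r ≤ (1 + r²) / 2` with `r = ‖γ' - ε φ'‖`, `‖γ'‖ ≤ 1` and `‖φ'‖ ≤ K'`.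
  set g : ℝ → ℝ := fun t => 1 - ε * ⟪deriv γ t, deriv φ t⟫ + K' ^ 2 / 2 * ε ^ 2 with hg
  have hgint : IntegrableOn g (Ioo 0 L) :=
    ((integrable_const _).sub (hint.const_mul ε)).add (integrable_const _)
  have hgval : ∫ t in Ioo 0 L, g t
      = L - ε * (∫ t in Ioo 0 L, ⟪deriv γ t, deriv φ t⟫) + K' ^ 2 / 2 * L * ε ^ 2 := by
    have hsub : ∫ t in Ioo 0 L, (1 - ε * ⟪deriv γ t, deriv φ t⟫)
        = (∫ _ in Ioo 0 L, (1 : ℝ)) - ε * ∫ t in Ioo 0 L, ⟪deriv γ t, deriv φ t⟫ := by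
      rw [integral_sub (integrable_const _) (hint.const_mul ε), integral_const_mul]
    have hadd : ∫ t in Ioo 0 L, g t = (∫ t in Ioo 0 L, (1 - ε * ⟪deriv γ t, deriv φ t⟫))
        + ∫ _ in Ioo 0 L, (K' : ℝ) ^ 2 / 2 * ε ^ 2 :=
      integral_add ((integrable_const _).sub (hint.const_mul ε)) (integrable_const _)
    rw [hadd, hsub]
    simp [hγ.nonneg]
    ring
  have hbound : ∀ᵐ t ∂(volume.restrict (Ioo 0 L)), ‖deriv (γ - ε • φ) t‖ ≤ g t := by
    filter_upwards [hγ.norm_deriv_le, ae_differentiableAt_Ioo hK] with t h1 h2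
    have h3 : DifferentiableAt ℝ φ t := hφ.differentiable (by norm_num) t
    have h4 : deriv (γ - ε • φ) t = deriv γ t - ε • deriv φ t :=
      (h2.hasDerivAt.sub (h3.hasDerivAt.const_smul ε)).deriv
    have h5 : ‖deriv γ t - ε • deriv φ t‖ ^ 2
        = ‖deriv γ t‖ ^ 2 - 2 * (ε * ⟪deriv γ t, deriv φ t⟫) + ε ^ 2 * ‖deriv φ t‖ ^ 2 := by
      rw [norm_sub_sq_real, inner_smul_right, norm_smul, mul_pow, Real.norm_eq_abs, sq_abs]
    have h6 : ‖deriv φ t‖ ^ 2 ≤ K' ^ 2 := by gcongr; exact hφd t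
    have h7 : ‖deriv γ t‖ ^ 2 ≤ 1 := pow_le_one₀ (norm_nonneg _) h1
    have h8 : ε ^ 2 * ‖deriv φ t‖ ^ 2 ≤ ε ^ 2 * K' ^ 2 := by gcongr
    rw [h4, hg]
    simp only
    nlinarith [sq_nonneg (‖deriv γ t - ε • deriv φ t‖ - 1)]
  -- The nonnegativity lets `ENNReal.ofReal` be stripped when energies are compared.
  refine ⟨⟨_, hlip⟩, ?_, ?_⟩
  · rw [← hgval]
    refine integral_nonneg_of_ae ?_
    filter_upwards [hbound] with t ht using (norm_nonneg _).trans ht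
  · rw [← hgval]
    exact eVariationOn_le_integral_of_lipschitzOnWith hγ.nonneg hlip hgint hbound

/-- The first variation of the energy in the direction `-φ`, when the points moving away from the
curve are accounted for by the set `A`. -/
theorem IsMinimizer.integral_inner_deriv_le (hμ : IsData μ) (hp : 1 ≤ p) (hlam : 0 < lam)
    (hmin : IsMinimizer μ lam p L γ) (harc : HasUnitSpeedOn γ (Icc 0 L))
    {φ : ℝ → Space d} (hφ : ContDiff ℝ 1 φ) (hφc : HasCompactSupport φ)
    {X : Type*} [MeasurableSpace X] {ν : Measure X} {f : X → Space d} (hf : Measurable f)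
    (hν : ν.map f = μ) {A : Set X} (hA : MeasurableSet A)
    (hdist : ∀ ε : ℝ, 0 < ε → ∀ᵐ z ∂ν, Metric.infDist (f z) (image L (γ - ε • φ)) ≤
      Metric.infDist (f z) (image L γ) + A.indicator (fun _ => ε) z) :
    ENNReal.ofReal (∫ t in Ioo 0 L, ⟪deriv γ t, deriv φ t⟫) ≤
      ENNReal.ofReal (p / lam * Metric.diam μ.support ^ (p - 1)) * ν A := by
  have := hμ.finite
  have hL := hmin.isCurve.nonneg
  have hνfin : IsFiniteMeasure ν := by
    refine ⟨?_⟩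
    rw [← preimage_univ (f := f), ← Measure.map_apply hf MeasurableSet.univ, hν]
    exact measure_lt_top _ _
  set D := Metric.diam μ.support with hD
  have hD0 : 0 ≤ D := Metric.diam_nonneg
  have hp0 : 0 < p := by linarith
  set J := ∫ t in Ioo 0 L, ⟪deriv γ t, deriv φ t⟫ with hJ
  obtain ⟨C, hC⟩ := exists_eVariationOn_sub_smul_le hmin.isCurve hφ hφc
  have hfin := hμ.energy_ne_top hp hmin
  have hlen : eVariationOn γ (Icc 0 L) = ENNReal.ofReal L := by
    simpa using harc (left_mem_Icc.2 hL) (right_mem_Icc.2 hL)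
  have hpull : ∀ s : Set (Space d), ∫⁻ x, Metric.infEDist x s ^ p ∂μ
      = ∫⁻ z, Metric.infEDist (f z) s ^ p ∂ν := fun s => by
    rw [← hν, lintegral_map (Metric.continuous_infEDist.measurable.pow_const p) hf]
  have hnear : ∀ᵐ z ∂ν, Metric.infDist (f z) (image L γ) ≤ D := by
    have : ∀ᵐ x ∂(ν.map f), Metric.infDist x (image L γ) ≤ D := by
      rw [hν]
      filter_upwards [Measure.support_mem_ae (μ := μ)] with x hx
      exact hmin.infDist_le_diam hμ hp hx
    exact ae_of_ae_map hf.aemeasurable this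
  have hstep : ∀ ε : ℝ, 0 < ε →
      lam * J ≤ p * (D + ε) ^ (p - 1) * ν.real A + lam * C * ε := by
    intro ε hε
    obtain ⟨⟨K, hK⟩, hnn, hvar⟩ := hC ε hε
    have hle := hmin.le_of_lipschitzOnWith hL hK
    set c := p * ε * (D + ε) ^ (p - 1) with hc
    have hc0 : 0 ≤ c := by positivity
    have hint : ∫⁻ z, Metric.infEDist (f z) (image L (γ - ε • φ)) ^ p ∂ν ≤
        ∫⁻ z, Metric.infEDist (f z) (image L γ) ^ p ∂ν + ENNReal.ofReal c * ν A := by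
      rw [← lintegral_indicator_const hA, ← lintegral_add_right _ (measurable_const.indicator hA)]
      refine lintegral_mono_ae ?_
      filter_upwards [hdist ε hε, hnear] with z h1 h2
      rw [infEDist_eq_ofReal (image_nonempty hL _), infEDist_eq_ofReal (image_nonempty hL _),
        ENNReal.ofReal_rpow_of_nonneg Metric.infDist_nonneg hp0.le,
        ENNReal.ofReal_rpow_of_nonneg Metric.infDist_nonneg hp0.le]
      have h0 := Metric.infDist_nonneg (x := f z) (s := image L γ)
      by_cases hz : z ∈ A
      · rw [indicator_of_mem hz] at h1 ⊢
        rw [← ENNReal.ofReal_add (by positivity) hc0]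
        refine ENNReal.ofReal_le_ofReal ?_
        exact (Real.rpow_le_rpow Metric.infDist_nonneg h1 hp0.le).trans
          (add_rpow_le_rpow_add_mul hp h0 hε h2)
      · rw [indicator_of_notMem hz, add_zero] at h1 ⊢
        exact ENNReal.ofReal_le_ofReal (Real.rpow_le_rpow Metric.infDist_nonneg h1 hp0.le)
    rw [energy, energy, hpull, hpull, hlen] at hle
    rw [energy, hpull] at hfin
    have hfin1 : (∫⁻ z, Metric.infEDist (f z) (image L γ) ^ p ∂ν) ≠ ∞ :=
      ne_top_of_le_ne_top hfin le_self_add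
    have hcomb := hle.trans (add_le_add hint (mul_le_mul_right hvar (ENNReal.ofReal lam)))
    rw [add_assoc, ENNReal.add_le_add_iff_left hfin1, ← ENNReal.ofReal_mul hlam.le,
      ← ENNReal.ofReal_mul hlam.le, ← ofReal_measureReal, ← ENNReal.ofReal_mul hc0,
      ← ENNReal.ofReal_add (by positivity) (by positivity),
      ENNReal.ofReal_le_ofReal_iff (by positivity)] at hcomb
    refine le_of_mul_le_mul_left (?_ : ε * _ ≤ ε * _) hε
    rw [hc] at hcomb
    linarith
  -- As `p - 1 ≥ 0`, the power is continuous even at base `0`; for `p = 1` it is constantly `1`,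
  -- including `0 ^ 0`.
  have hlim : lam * J ≤ p * D ^ (p - 1) * ν.real A := by
    have hcont : Continuous fun ε : ℝ =>
        p * (D + ε) ^ (p - 1) * ν.real A + lam * C * ε := by
      have : Continuous fun ε : ℝ => (D + ε) ^ (p - 1) :=
        (continuous_const.add continuous_id).rpow_const fun _ => Or.inr (by linarith)
      fun_prop
    have ht := (hcont.tendsto 0).mono_left (nhdsWithin_le_nhds (s := Ioi 0))
    simp only [add_zero, mul_zero] at ht
    exact ge_of_tendsto ht (eventually_mem_nhdsWithin.mono hstep)
  rw [← ofReal_measureReal, ← ENNReal.ofReal_mul (by positivity)]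
  refine ENNReal.ofReal_le_ofReal ?_
  rw [← mul_le_mul_iff_right₀ hlam]
  refine hlim.trans_eq ?_
  field_simp

/-! ### Total variation bounds -/

theorem setIntegral_inner_deriv_eq {u φ : ℝ → Space d} {a b : ℝ} (hsub : Ioo a b ⊆ Ioo 0 L)
    (hφ : tsupport φ ⊆ Ioo a b) :
    ∫ t in Ioo a b, ⟪u t, deriv φ t⟫ = ∫ t in Ioo 0 L, ⟪u t, deriv φ t⟫ := by
  refine (setIntegral_eq_of_subset_of_forall_sdiff_eq_zero measurableSet_Ioo hsub fun t ht => ?_).symm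
  rw [image_eq_zero_of_notMem_tsupport fun h => ht.2 (hφ (tsupport_deriv_subset h)),
    inner_zero_right]

theorem IsMinimizer.totalVariation_le (hμ : IsData μ) (hp : 1 ≤ p) (hlam : 0 < lam)
    (hmin : IsMinimizer μ lam p L γ) (harc : HasUnitSpeedOn γ (Icc 0 L)) :
    totalVariation (deriv γ) 0 L ≤
      ENNReal.ofReal (p / lam * Metric.diam μ.support ^ (p - 1)) * μ univ := by
  refine iSup₂_le fun φ hφ => ?_
  obtain ⟨hφ1, hφc, -, hφn⟩ := hφ
  obtain ⟨K, hK⟩ := hmin.isCurve.lipschitz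
  refine hmin.integral_inner_deriv_le hμ hp hlam harc hφ1 hφc measurable_id Measure.map_id
    MeasurableSet.univ fun ε hε => Eventually.of_forall fun x => ?_
  obtain ⟨y, ⟨s, hs, rfl⟩, hy⟩ := (isCompact_image hK).exists_infDist_eq_dist
    (image_nonempty hmin.isCurve.nonneg γ) x
  rw [id, hy, indicator_of_mem (mem_univ x)]
  refine (Metric.infDist_le_dist_of_mem (mem_image_of_mem _ hs)).trans
    ((dist_triangle _ (γ s) _).trans ?_)
  gcongr
  rw [dist_eq_norm]
  simp only [Pi.sub_apply, Pi.smul_apply, sub_sub_cancel, norm_smul, Real.norm_eq_abs,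
    abs_of_pos hε]
  nlinarith [hφn s]

theorem IsMinimizer.totalVariation_le_of_isProjectionPlan (hμ : IsData μ) (hp : 1 ≤ p)
    (hlam : 0 < lam) (hmin : IsMinimizer μ lam p L γ) (harc : HasUnitSpeedOn γ (Icc 0 L))
    {π : Measure (Space d × Space d)} (hπ : IsProjectionPlan μ (image L γ) π) {a b : ℝ}
    (hab : Ioo a b ⊆ Icc 0 L) :
    totalVariation (deriv γ) a b ≤
      ENNReal.ofReal (p / lam * Metric.diam μ.support ^ (p - 1)) *
        π.map Prod.snd (γ '' Ioo a b) := by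
  have hsub : Ioo a b ⊆ Ioo 0 L := by
    rw [← interior_Icc (a := (0 : ℝ))]
    exact isOpen_Ioo.subset_interior_iff.2 hab
  refine iSup₂_le fun φ hφ => ?_
  obtain ⟨hφ1, hφc, hφs, hφn⟩ := hφ
  obtain ⟨K, hK⟩ := hmin.isCurve.lipschitz
  -- This image is compact, hence measurable; for `γ '' Ioo a b` monotonicity of the measure
  -- suffices.
  have hmeas : MeasurableSet (γ '' tsupport φ) :=
    (IsCompact.image_of_continuousOn hφc (hK.continuousOn.mono (hφs.trans hab))).measurableSet
  have hle : π (Prod.snd ⁻¹' (γ '' tsupport φ)) ≤ π.map Prod.snd (γ '' Ioo a b) := by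
    rw [← Measure.map_apply measurable_snd hmeas]
    exact measure_mono (image_mono hφs)
  rw [setIntegral_inner_deriv_eq hsub hφs]
  refine le_trans ?_ (mul_le_mul_right hle _)
  refine hmin.integral_inner_deriv_le hμ hp hlam harc hφ1 hφc measurable_fst hπ.fst_eq
    (measurable_snd hmeas) fun ε hε => ?_
  filter_upwards [hπ.mem, hπ.closest] with z hz1 hz2
  obtain ⟨s, hs, hsz⟩ := hz1
  rw [← hz2]
  refine (Metric.infDist_le_dist_of_mem (mem_image_of_mem _ hs)).trans
    ((dist_triangle _ z.2 _).trans ?_)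
  gcongr
  rw [← hsz, dist_eq_norm]
  simp only [Pi.sub_apply, Pi.smul_apply, sub_sub_cancel, norm_smul, Real.norm_eq_abs,
    abs_of_pos hε]
  -- Off `tsupport φ` the nearest point `γ s` stays on the perturbed curve, so the distance does not
  -- grow.
  by_cases hst : s ∈ tsupport φ
  · rw [indicator_of_mem (show z ∈ Prod.snd ⁻¹' (γ '' tsupport φ) from ⟨s, hst, hsz⟩)]
    nlinarith [hφn s]
  · rw [image_eq_zero_of_notMem_tsupport hst, norm_zero, mul_zero]
    exact indicator_nonneg (fun _ _ => hε.le) z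

end AvgDist

theorem proposition4p2 (d : ℕ) (μ : Measure (Space d)) (hμ : IsData μ)
    (p lam : ℝ) (hp : 1 ≤ p) (hlam : 0 < lam)
    (L : ℝ) (γ : ℝ → Space d)
    (hmin : IsMinimizer μ lam p L γ) (harc : HasUnitSpeedOn γ (Icc 0 L)) :
    IsBV (deriv γ) 0 L ∧
    totalVariation (deriv γ) 0 L ≤
      ENNReal.ofReal (p / lam * Metric.diam μ.support ^ (p - 1)) * μ univ ∧
    ∀ π : Measure (Space d × Space d), IsProjectionPlan μ (image L γ) π →
      ∀ σ : Measure (Space d), σ = π.map Prod.snd →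
      ∀ t δ : ℝ, 0 < δ → Ioo t (t + δ) ⊆ Icc 0 L →
        totalVariation (deriv γ) t (t + δ) ≤
          ENNReal.ofReal (p / lam * Metric.diam μ.support ^ (p - 1)) *
            σ (γ '' Ioo t (t + δ)) := by
  have hTV := hmin.totalVariation_le hμ hp hlam harc
  have hfin := hμ.finite
  refine ⟨⟨?_, hTV.trans_lt (ENNReal.mul_lt_top ENNReal.ofReal_lt_top (measure_lt_top _ _))⟩,
    hTV, ?_⟩
  · exact Integrable.of_bound (stronglyMeasurable_deriv γ).aestronglyMeasurable 1
      hmin.isCurve.norm_deriv_le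
  · rintro π hπ σ rfl t δ - hsub
    exact hmin.totalVariation_le_of_isProjectionPlan hμ hp hlam harc hπ hsub
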